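/- Let $X \in M_m \otimes M_n$ be a density matrix ($X \ge 0$, $\operatorname{Tr} X = 1$), and let $X_1 = \operatorname{Tr}_2 X \in M_m$ be its reduced density matrix. Write $\|A\|_p = (\operatorname{Tr}|A|^p)^{1/p}$ for the Schatten norm and, for $p > 1$ and $p' = p/(p-1)$, let $$\|X\|_{(1,p)} = \inf\bigl\{ \|A\|_{2p'}\,\|C\|_{2p'}\,\|Z\|_p \;:\; X = (A\otimes I_n)\,Z\,(C\otimes I_n),\ A, C\in M_m,\ Z\in M_m\otimes M_n\bigr\}$$ be the norm of $X$ in $L_1(M_m;L_p(M_n))$. For each $p\in(1,2]$ let $B(p)\in M_m$ be a density matrix (positive semidefinite, of trace one) with $\ker B(p)\subseteq\ker X_1$ that minimizes $\|X\|_{(1,p)}$, i.e. $$\bigl\| X^{1/2}\,(B(p)^{\frac1p-1}\otimes I_n)\,X^{1/2}\bigr\|_p = \|X\|_{(1,p)},$$ where the negative power $B(p)^{\frac1p-1}$ is taken on $(\ker B(p))^\perp$ and is $0$ on $\ker B(p)$. Then $$\lim_{p\to 1+} B(p) = X_1 .$$ -/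

import Mathlib

open Filter Topology
open scoped Matrix Kronecker ComplexOrder

noncomputable section

namespace MixedNorm

/-- The real power `A ^ s = ∑ₖ λₖ ^ s |φₖ⟩⟨φₖ|` of a positive semidefinite matrix with spectral
decomposition `A = ∑ₖ λₖ |φₖ⟩⟨φₖ|`. For `s ≠ 0` it vanishes on `ker A` (as `0 ^ s = 0`), so a
negative power is the power of the inverse on `(ker A)ᗮ`. -/
def matPow {ι : Type*} [Fintype ι] [DecidableEq ι] (A : Matrix ι ι ℂ) (s : ℝ) : Matrix ι ι ℂ :=
  cfc (fun t : ℝ => t ^ s) A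

/-- The Schatten norm `‖A‖_p = (Tr |A| ^ p) ^ (1 / p)`, where `|A| ^ p = (Aᴴ A) ^ (p / 2)`. -/
def schattenNorm {ι : Type*} [Fintype ι] [DecidableEq ι] (p : ℝ) (A : Matrix ι ι ℂ) : ℝ :=
  ((matPow (Aᴴ * A) (p / 2)).trace.re) ^ (1 / p)

/-- The embedding `A ↦ A ⊗ Iₙ` of `M_m` into `M_m ⊗ M_n`. -/
def ampl {m : ℕ} (n : ℕ) (A : Matrix (Fin m) (Fin m) ℂ) :
    Matrix (Fin m × Fin n) (Fin m × Fin n) ℂ :=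
  A ⊗ₖ (1 : Matrix (Fin n) (Fin n) ℂ)

/-- The partial trace over the second factor, `Tr₂ : M_m ⊗ M_n → M_m`. -/
def partialTrace₂ {m n : ℕ} (X : Matrix (Fin m × Fin n) (Fin m × Fin n) ℂ) :
    Matrix (Fin m) (Fin m) ℂ :=
  Matrix.of fun i j => ∑ k : Fin n, X (i, k) (j, k)

/-- Density matrices: positive semidefinite matrices of trace one. -/
def IsDensity {ι : Type*} [Fintype ι] (A : Matrix ι ι ℂ) : Prop :=
  A.PosSemidef ∧ A.trace = 1

/-- The norm of `L₁(M_m; L_p(M_n))` for `1 < p < ∞`: the infimum of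
`‖A‖_{2p'} ‖B‖_{2p'} ‖Z‖_p` over all factorizations `Y = (A ⊗ I) Z (B ⊗ I)`, where `A, B ∈ M_m`,
`Z ∈ M_m ⊗ M_n` and `p' = p / (p - 1)` is the conjugate exponent. -/
def norm1p {m n : ℕ} (p : ℝ) (Y : Matrix (Fin m × Fin n) (Fin m × Fin n) ℂ) : ℝ :=
  sInf {c : ℝ | ∃ (A B : Matrix (Fin m) (Fin m) ℂ)
      (Z : Matrix (Fin m × Fin n) (Fin m × Fin n) ℂ),
    Y = ampl n A * Z * ampl n B ∧
    c = schattenNorm (2 * (p / (p - 1))) A * schattenNorm (2 * (p / (p - 1))) B *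
      schattenNorm p Z}

/-- `v(p, B) = X ^ (1/2) (B ^ (1/p - 1) ⊗ I) X ^ (1/2)`. -/
def vMat {m n : ℕ} (X : Matrix (Fin m × Fin n) (Fin m × Fin n) ℂ) (p : ℝ)
    (B : Matrix (Fin m) (Fin m) ℂ) : Matrix (Fin m × Fin n) (Fin m × Fin n) ℂ :=
  matPow X (1 / 2) * ampl n (matPow B (1 / p - 1)) * matPow X (1 / 2)

/-- The density matrices `B` with `ker B ⊆ ker (Tr₂ X)`. These are the density matrices for which
the negative power `B ^ (1/p - 1)` in `v(p, B)` is meaningful for `p > 1`. -/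
def admissible {m n : ℕ} (X : Matrix (Fin m × Fin n) (Fin m × Fin n) ℂ) :
    Set (Matrix (Fin m) (Fin m) ℂ) :=
  {B | IsDensity B ∧
    LinearMap.ker B.mulVecLin ≤ LinearMap.ker (partialTrace₂ X).mulVecLin}

/-- `B` is a density matrix that minimizes `‖X‖_{(1,p)}`, i.e. `‖v(p, B)‖_p = ‖X‖_{(1,p)}`. -/
def IsMinimizer {m n : ℕ} (X : Matrix (Fin m × Fin n) (Fin m × Fin n) ℂ) (p : ℝ)
    (B : Matrix (Fin m) (Fin m) ℂ) : Prop :=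
  B ∈ admissible X ∧ schattenNorm p (vMat X p B) = norm1p p X

end MixedNorm

end

/-! Put `ε = 1 - 1/p`, `S = Tr₂ X`, `Y = Tr₂ X ^ (1 + ε)`, and let `H` be the entropy `Tr (negMulLog
·)`. The plan is to bound `D = ‖Y - B(p)‖₂²` by quantities that cancel as `p → 1+`; since `Y → S`,
this suffices.

The number `Tr (v(p, B) X ^ ε) = Tr (Y B ^ (-ε))` is estimated from both sides. From above, Young's
inequality (`trace_mul_matPow_le`) gives at most `Tr v(p, B) ^ p / p + ε`, and minimality replaces
`Tr v(p, B) ^ p` by `T = Tr v(p, S) ^ p`. From below, Gibbs' inequality with a quadratic remainder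
(`entropy_le_trace_mul_matPow`) gives `Tr Y + ε (H(Y) + Tr Y - 1 + D/4)`, where `Tr Y ≥ 1 - ε H(X)`.
Dividing by `ε`, `D/4 ≤ (T - 1)/(p - 1) + H(X) - H(Y) - Tr Y + 1`.

Since `Tr v(p, S) = Tr S ^ (1/p)`, the quotient splits into `(Tr S ^ (1/p) - 1)/(p - 1) → H(S)` and
a difference quotient of `Tr v ^ p` with `v = v(p, S) → X`, whose upper limit is at most `-H(X)`.
Everything cancels. Minimality enters only through comparison with the competitor `S`; no formula
for the norm as a minimum over `B` is needed. -/

namespace MixedNorm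

/-! ### Functional calculus of Hermitian matrices: traces and limits -/

section FunctionalCalculus

variable {ι : Type*} [Fintype ι] [DecidableEq ι] {A B : Matrix ι ι ℂ}

lemma continuousOn_spectrum (f : ℝ → ℝ) (A : Matrix ι ι ℂ) : ContinuousOn f (spectrum ℝ A) :=
  A.finite_real_spectrum.continuousOn f

lemma isHermitian_cfc (f : ℝ → ℝ) (A : Matrix ι ι ℂ) : (cfc f A).IsHermitian :=
  cfc_predicate f A

lemma cfc_congr_eigenvalues (hA : A.IsHermitian) {f g : ℝ → ℝ}
    (h : ∀ i, f (hA.eigenvalues i) = g (hA.eigenvalues i)) : cfc f A = cfc g A := by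
  refine cfc_congr fun x hx => ?_
  obtain ⟨i, rfl⟩ := hA.spectrum_real_eq_range_eigenvalues ▸ hx
  exact h i

lemma cfc_congr_nonneg (hA : A.PosSemidef) {f g : ℝ → ℝ} (h : ∀ t, 0 ≤ t → f t = g t) :
    cfc f A = cfc g A :=
  cfc_congr_eigenvalues hA.1 fun i => h _ (hA.eigenvalues_nonneg i)

lemma cfc_mul_cfc (f g : ℝ → ℝ) (A : Matrix ι ι ℂ) :
    cfc f A * cfc g A = cfc (fun t => f t * g t) A :=
  (cfc_mul f g A (continuousOn_spectrum f A) (continuousOn_spectrum g A)).symm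

/-- Traces of functions of two Hermitian matrices as double sums over the eigenvalues, weighted
by the squared overlaps of the eigenvectors. -/
lemma exists_weights_trace_mul (hA : A.IsHermitian) (hB : B.IsHermitian) :
    ∃ c : ι → ι → ℝ, (∀ i j, 0 ≤ c i j) ∧ ∀ f g : ℝ → ℝ,
      (cfc f A * cfc g B).trace.re =
        ∑ i, ∑ j, c i j * (f (hA.eigenvalues i) * g (hB.eigenvalues j)) := by
  set U : Matrix ι ι ℂ := hA.eigenvectorUnitary.1
  set V : Matrix ι ι ℂ := hB.eigenvectorUnitary.1
  refine ⟨fun i j => Complex.normSq ((Uᴴ * V) i j), fun i j => Complex.normSq_nonneg _,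
    fun f g => ?_⟩
  have hA' : cfc f A =
      U * Matrix.diagonal (fun i => ((f (hA.eigenvalues i) : ℝ) : ℂ)) * Uᴴ := by
    rw [hA.cfc_eq, Matrix.IsHermitian.cfc, Unitary.conjStarAlgAut_apply]; rfl
  have hB' : cfc g B =
      V * Matrix.diagonal (fun i => ((g (hB.eigenvalues i) : ℝ) : ℂ)) * Vᴴ := by
    rw [hB.cfc_eq, Matrix.IsHermitian.cfc, Unitary.conjStarAlgAut_apply]; rfl
  have h : (cfc f A * cfc g B).trace =
      (Matrix.diagonal (fun i => ((f (hA.eigenvalues i) : ℝ) : ℂ)) * (Uᴴ * V) *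
        (Matrix.diagonal (fun i => ((g (hB.eigenvalues i) : ℝ) : ℂ)) * (Uᴴ * V)ᴴ)).trace := by
    rw [hA', hB', Matrix.conjTranspose_mul, Matrix.conjTranspose_conjTranspose]
    simp only [Matrix.mul_assoc]
    rw [Matrix.trace_mul_comm U]
    simp only [Matrix.mul_assoc]
  rw [h, Matrix.trace, Complex.re_sum]
  refine Finset.sum_congr rfl fun i _ => ?_
  rw [Matrix.diag_apply, Matrix.mul_apply, Complex.re_sum]
  refine Finset.sum_congr rfl fun j _ => ?_
  have hz : ∀ (z : ℂ) (x y : ℝ), ((x : ℂ) * z * (y * star z)).re = Complex.normSq z * (x * y) := by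
    intro z x y
    simp [Complex.normSq_apply]
    ring
  rw [Matrix.diagonal_mul, Matrix.diagonal_mul, Matrix.conjTranspose_apply]
  exact hz _ _ _

lemma trace_cfc (hA : A.IsHermitian) (f : ℝ → ℝ) :
    (cfc f A).trace = ∑ i, ((f (hA.eigenvalues i) : ℝ) : ℂ) := by
  rw [hA.cfc_eq, Matrix.IsHermitian.cfc, Unitary.conjStarAlgAut_apply, Matrix.trace_mul_cycle]
  simp [Matrix.trace]

lemma trace_cfc_re (hA : A.IsHermitian) (f : ℝ → ℝ) :
    (cfc f A).trace.re = ∑ i, f (hA.eigenvalues i) := by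
  rw [trace_cfc hA, ← Complex.ofReal_sum, Complex.ofReal_re]

lemma trace_cfc_eq_of_charpoly_eq (hA : A.IsHermitian) (hB : B.IsHermitian)
    (h : A.charpoly = B.charpoly) (f : ℝ → ℝ) : (cfc f A).trace = (cfc f B).trace := by
  rw [trace_cfc hA, trace_cfc hB, (hA.eigenvalues_eq_eigenvalues_iff hB).2 h]

lemma eigenvalues_le_trace (hA : A.PosSemidef) (i : ι) : hA.1.eigenvalues i ≤ A.trace.re := by
  rw [hA.1.trace_eq_sum_eigenvalues, Complex.re_sum]
  simpa using Finset.single_le_sum (f := hA.1.eigenvalues)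
    (fun j _ => hA.eigenvalues_nonneg j) (Finset.mem_univ i)

lemma posSemidef_cfc (hA : A.IsHermitian) {f : ℝ → ℝ} (h : ∀ i, 0 ≤ f (hA.eigenvalues i)) :
    (cfc f A).PosSemidef := by
  rw [hA.cfc_eq, Matrix.IsHermitian.cfc, Unitary.conjStarAlgAut_apply]
  refine Matrix.PosSemidef.mul_mul_conjTranspose_same ?_ _
  refine Matrix.PosSemidef.diagonal fun i => ?_
  simpa using h i

/-- For a fixed matrix the eigenbasis is fixed, so convergence at the finitely many eigenvalues is
enough. -/
lemma tendsto_cfc_of_pointwise {α : Type*} {l : Filter α} (hA : A.IsHermitian)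
    {F : α → ℝ → ℝ} {f : ℝ → ℝ}
    (h : ∀ i, Tendsto (fun x => F x (hA.eigenvalues i)) l (𝓝 (f (hA.eigenvalues i)))) :
    Tendsto (fun x => cfc (F x) A) l (𝓝 (cfc f A)) := by
  simp only [hA.cfc_eq, Matrix.IsHermitian.cfc, Unitary.conjStarAlgAut_apply]
  refine (tendsto_const_nhds.mul ?_).mul tendsto_const_nhds
  have hc : Continuous (fun d : ι → ℂ => Matrix.diagonal d) := by fun_prop
  refine (hc.tendsto _).comp (tendsto_pi_nhds.2 fun i => ?_)
  exact (Complex.continuous_ofReal.tendsto _).comp (h i)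

-- Here the matrix moves and the function is fixed: a convergent family eventually has all its
-- spectra in one compact ball.
open scoped Matrix.Norms.L2Operator in
lemma tendsto_cfc_of_tendsto {α : Type*} {l : Filter α} {a : α → Matrix ι ι ℂ} {f : ℝ → ℝ}
    (hf : Continuous f) (ha : ∀ᶠ x in l, (a x).IsHermitian) (hA : A.IsHermitian)
    (h : Tendsto a l (𝓝 A)) : Tendsto (fun x => cfc f (a x)) l (𝓝 (cfc f A)) := by
  have key : ∀ M : Matrix ι ι ℂ, ‖M‖ ≤ ‖A‖ + 1 → spectrum ℝ M ⊆
      Metric.closedBall (0 : ℝ) ((‖A‖ + 1) * ‖(1 : Matrix ι ι ℂ)‖) := fun M hM t ht => by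
    rw [mem_closedBall_zero_iff]
    exact (spectrum.norm_le_norm_mul_of_mem ht).trans
      (mul_le_mul_of_nonneg_right hM (norm_nonneg _))
  refine Filter.Tendsto.cfc (p := IsSelfAdjoint) (isCompact_closedBall _ _) f h ?_ ha
    (key A (by linarith)) hA hf.continuousOn
  filter_upwards [h.norm.eventually_le_const (lt_add_one ‖A‖)] with x hx using key _ hx

end FunctionalCalculus

/-! ### Powers of matrices; Gibbs and Young inequalities under the trace -/

section TraceInequalities

variable {ι : Type*} [Fintype ι] [DecidableEq ι] {A B : Matrix ι ι ℂ}

lemma matPow_one (hA : A.IsHermitian) : matPow A 1 = A := by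
  simp only [matPow, Real.rpow_one]
  exact cfc_id' ℝ A hA

lemma isHermitian_matPow (A : Matrix ι ι ℂ) (s : ℝ) : (matPow A s).IsHermitian :=
  isHermitian_cfc _ A

lemma posSemidef_matPow (hA : A.PosSemidef) (s : ℝ) : (matPow A s).PosSemidef :=
  posSemidef_cfc hA.1 fun i => Real.rpow_nonneg (hA.eigenvalues_nonneg i) s

/-- The case `s + t = 0` is excluded because `0 ^ 0 = 1` would make the right side the identity even
on the kernel. -/
lemma matPow_mul_matPow (hA : A.PosSemidef) {s t : ℝ} (h : s + t ≠ 0) :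
    matPow A s * matPow A t = matPow A (s + t) := by
  simp only [matPow, cfc_mul_cfc]
  exact cfc_congr_nonneg hA fun x hx => (Real.rpow_add' hx h).symm

lemma matPow_matPow (hA : A.PosSemidef) (s t : ℝ) :
    matPow (matPow A s) t = matPow A (s * t) := by
  have h : cfc (fun x : ℝ => (x ^ s) ^ t) A = matPow (matPow A s) t :=
    cfc_comp' (fun x : ℝ => x ^ t) (fun x : ℝ => x ^ s) A
      ((A.finite_real_spectrum.image _).continuousOn _) (continuousOn_spectrum _ A) hA.1
  rw [← h]
  exact cfc_congr_nonneg hA fun x hx => (Real.rpow_mul hx s t).symm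

lemma trace_matPow_re_nonneg (hA : A.PosSemidef) (s : ℝ) : 0 ≤ (matPow A s).trace.re :=
  (Complex.le_def.1 (posSemidef_matPow hA s).trace_nonneg).1

/-- Using `log x ≤ x - 1` at `x = √(t/y)` rather than at `t/y` leaves the remainder `(√y - √t)²`. It
dominates `(y - t)²/4` because `√y + √t ≤ 2`. -/
lemma quarter_sq_sub_le {y t : ℝ} (hy : 0 ≤ y) (hy1 : y ≤ 1) (ht : 0 < t) (ht1 : t ≤ 1) :
    Real.negMulLog y + y - t + (y - t) ^ 2 / 4 ≤ -(y * Real.log t) := by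
  rcases hy.eq_or_lt with rfl | hy
  · simp; nlinarith
  have h1 : Real.log (Real.sqrt t / Real.sqrt y) ≤ Real.sqrt t / Real.sqrt y - 1 :=
    Real.log_le_sub_one_of_pos (by positivity)
  rw [Real.log_div (by positivity) (by positivity), Real.log_sqrt ht.le, Real.log_sqrt hy.le] at h1
  obtain ⟨a, ha, rfl⟩ : ∃ a : ℝ, 0 < a ∧ y = a ^ 2 := ⟨√y, by positivity, (Real.sq_sqrt hy.le).symm⟩
  obtain ⟨b, hb, rfl⟩ : ∃ b : ℝ, 0 < b ∧ t = b ^ 2 := ⟨√t, by positivity, (Real.sq_sqrt ht.le).symm⟩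
  rw [Real.sqrt_sq ha.le, Real.sqrt_sq hb.le] at h1
  have h2 := mul_le_mul_of_nonneg_left h1 (sq_nonneg a)
  have h3 : a ^ 2 * (b / a - 1) = a * b - a ^ 2 := by field_simp
  rw [h3] at h2
  have ha1 : a ≤ 1 := by nlinarith
  have hb1 : b ≤ 1 := by nlinarith
  have h4 : (a ^ 2 - b ^ 2) ^ 2 / 4 ≤ (a - b) ^ 2 := by
    have : (a + b) ^ 2 ≤ 4 := by nlinarith
    nlinarith [mul_le_mul_of_nonneg_left this (sq_nonneg (a - b))]
  rw [Real.negMulLog]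
  nlinarith

lemma entropy_le_mul_rpow {y t ε : ℝ} (hy : 0 ≤ y) (hy1 : y ≤ 1) (ht : 0 < t) (ht1 : t ≤ 1)
    (hε : 0 < ε) :
    y + ε * (Real.negMulLog y + y - t + (y - t) ^ 2 / 4) ≤ y * t ^ (-ε) := by
  have h1 := mul_le_mul_of_nonneg_left (quarter_sq_sub_le hy hy1 ht ht1) hε.le
  have h2 : 1 - ε * Real.log t ≤ t ^ (-ε) := by
    rw [Real.rpow_def_of_pos ht]
    have := Real.add_one_le_exp (Real.log t * -ε)
    linarith
  have h3 := mul_le_mul_of_nonneg_left h2 hy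
  linarith

/-- A quantitative Gibbs inequality: the last term measures the distance from `B` to `A`. -/
lemma entropy_le_trace_mul_matPow (hA : A.PosSemidef) (hB : B.PosSemidef) (hA1 : A.trace.re ≤ 1)
    (hB1 : B.trace.re ≤ 1) {ε : ℝ} (hε : 0 < ε)
    (hker : (A * cfc (fun t : ℝ => if t = 0 then 1 else 0) B).trace.re = 0) :
    A.trace.re + ε * ((cfc Real.negMulLog A).trace.re + A.trace.re - B.trace.re +
      ((A - B) * (A - B)).trace.re / 4) ≤ (A * matPow B (-ε)).trace.re := by
  obtain ⟨c, hc, h⟩ := exists_weights_trace_mul hA.1 hB.1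
  have hA_id : cfc (fun t : ℝ => t) A = A := cfc_id' ℝ A hA.1
  have hB_id : cfc (fun t : ℝ => t) B = B := cfc_id' ℝ B hB.1
  have hA_one : cfc (fun _ : ℝ => (1 : ℝ)) A = 1 := cfc_const_one ℝ A hA.1
  have hB_one : cfc (fun _ : ℝ => (1 : ℝ)) B = 1 := cfc_const_one ℝ B hB.1
  have e1 := h (fun t => t) (fun _ => 1)
  have e2 := h Real.negMulLog (fun _ => 1)
  have e3 := h (fun _ => 1) (fun t => t)
  have e4 := h (fun t => t * t) (fun _ => 1)
  have e5 := h (fun t => t) (fun t => t)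
  have e6 := h (fun _ => 1) (fun t => t * t)
  have e7 := h (fun t => t) (fun t => t ^ (-ε))
  have e8 := h (fun t => t) (fun t : ℝ => if t = 0 then 1 else 0)
  rw [← cfc_mul_cfc] at e4 e6
  rw [hA_id] at e1 e4 e5 e7 e8
  rw [hB_id] at e3 e5 e6
  rw [hB_one, mul_one] at e1 e2 e4
  rw [hA_one, one_mul] at e3 e6
  rw [hker] at e8
  -- The scalar inequality needs `t > 0`, as `0 ^ (-ε) = 0` here; the support condition `hker`
  -- disposes of the terms with `t = 0`.
  have hzero : ∀ i j, hB.1.eigenvalues j = 0 → c i j * hA.1.eigenvalues i = 0 := by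
    intro i j hj
    have hnn : ∀ i j, 0 ≤ c i j * (hA.1.eigenvalues i *
        (if hB.1.eigenvalues j = 0 then 1 else 0)) := fun i j =>
      mul_nonneg (hc i j) (mul_nonneg (hA.eigenvalues_nonneg i) (by split_ifs <;> norm_num))
    have h1 := (Finset.sum_eq_zero_iff_of_nonneg
      fun i _ => Finset.sum_nonneg fun j _ => hnn i j).1 e8.symm i (Finset.mem_univ i)
    have h2 := (Finset.sum_eq_zero_iff_of_nonneg fun j _ => hnn i j).1 h1 j (Finset.mem_univ j)
    simpa [hj] using h2
  have hsq : ((A - B) * (A - B)).trace.re =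
      (A * A).trace.re - 2 * (A * B).trace.re + (B * B).trace.re := by
    rw [sub_mul, mul_sub, mul_sub, Matrix.trace_sub, Matrix.trace_sub, Matrix.trace_sub,
      Matrix.trace_mul_comm B A]
    simp only [Complex.sub_re]
    ring
  rw [matPow, e7, hsq, e1, e2, e3, e4, e5, e6]
  simp only [Finset.mul_sum, Finset.sum_div, ← Finset.sum_add_distrib, ← Finset.sum_sub_distrib]
  refine Finset.sum_le_sum fun i _ => Finset.sum_le_sum fun j _ => ?_
  have hyi := hA.eigenvalues_nonneg i
  have hyi1 := (eigenvalues_le_trace hA i).trans hA1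
  have htj1 := (eigenvalues_le_trace hB j).trans hB1
  rcases (hB.eigenvalues_nonneg j).eq_or_lt with h0 | hpos
  · rcases mul_eq_zero.1 (hzero i j h0.symm) with h1 | h1
    · simp [h1]
    · simp [h1, ← h0]
  · have := mul_le_mul_of_nonneg_left (entropy_le_mul_rpow hyi hyi1 hpos htj1 hε) (hc i j)
    linarith

/-- Young's inequality under the trace. -/
lemma trace_mul_matPow_le (hA : A.PosSemidef) (hB : B.PosSemidef) {p : ℝ} (hp : 1 < p) :
    (A * matPow B (1 - 1 / p)).trace.re ≤
      (matPow A p).trace.re / p + (1 - 1 / p) * B.trace.re := by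
  have hpq : p.HolderConjugate (1 - 1 / p)⁻¹ := by
    rw [Real.holderConjugate_iff]
    exact ⟨hp, by simp⟩
  obtain ⟨c, hc, h⟩ := exists_weights_trace_mul hA.1 hB.1
  have e1 := h (fun t => t) (fun t => t ^ (1 - 1 / p))
  have e2 := h (fun t => t ^ p) (fun _ => 1)
  have e3 := h (fun _ => 1) (fun t => t)
  have hA_id : cfc (fun t : ℝ => t) A = A := cfc_id' ℝ A hA.1
  have hB_id : cfc (fun t : ℝ => t) B = B := cfc_id' ℝ B hB.1
  have hA_one : cfc (fun _ : ℝ => (1 : ℝ)) A = 1 := cfc_const_one ℝ A hA.1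
  have hB_one : cfc (fun _ : ℝ => (1 : ℝ)) B = 1 := cfc_const_one ℝ B hB.1
  rw [hA_id] at e1
  rw [hB_one, mul_one] at e2
  rw [hA_one, one_mul, hB_id] at e3
  rw [matPow, matPow, e1, e2, e3]
  simp only [Finset.mul_sum, Finset.sum_div, ← Finset.sum_add_distrib]
  refine Finset.sum_le_sum fun i _ => Finset.sum_le_sum fun j _ => ?_
  have hy := Real.young_inequality_of_nonneg (hA.eigenvalues_nonneg i)
    (Real.rpow_nonneg (hB.eigenvalues_nonneg j) (1 - 1 / p)) hpq
  rw [Real.rpow_rpow_inv (hB.eigenvalues_nonneg j) (inv_eq_zero.not.1 hpq.symm.ne_zero),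
    div_inv_eq_mul] at hy
  have := mul_le_mul_of_nonneg_left hy (hc i j)
  linear_combination this

end TraceInequalities

/-! ### Schatten norms -/

section Schatten

variable {ι : Type*} [Fintype ι] [DecidableEq ι] {A : Matrix ι ι ℂ}

lemma schattenNorm_nonneg (p : ℝ) (A : Matrix ι ι ℂ) : 0 ≤ schattenNorm p A :=
  Real.rpow_nonneg (trace_matPow_re_nonneg (Matrix.posSemidef_conjTranspose_mul_self A) _) _

lemma schattenNorm_of_posSemidef (hA : A.PosSemidef) (p : ℝ) :
    schattenNorm p A = (matPow A p).trace.re ^ (1 / p) := by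
  have h : Aᴴ * A = matPow A 2 := by
    rw [hA.1, ← one_add_one_eq_two, ← matPow_mul_matPow hA (by norm_num), matPow_one hA.1]
  rw [schattenNorm, h, matPow_matPow hA, mul_div_cancel₀ _ two_ne_zero]

lemma schattenNorm_conjTranspose_mul_self (p : ℝ) (A : Matrix ι ι ℂ) :
    schattenNorm p (Aᴴ * A) = schattenNorm p (A * Aᴴ) := by
  rw [schattenNorm_of_posSemidef (Matrix.posSemidef_conjTranspose_mul_self A),
    schattenNorm_of_posSemidef (Matrix.posSemidef_self_mul_conjTranspose A), matPow, matPow,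
    trace_cfc_eq_of_charpoly_eq (Matrix.posSemidef_conjTranspose_mul_self A).1
      (Matrix.posSemidef_self_mul_conjTranspose A).1 (Matrix.charpoly_mul_comm _ _)]

end Schatten

/-! ### Partial trace, supports, and the marginal as a competitor -/

section Tensor

variable {m n : ℕ} {X : Matrix (Fin m × Fin n) (Fin m × Fin n) ℂ}

lemma ampl_mul (A B : Matrix (Fin m) (Fin m) ℂ) : ampl n (A * B) = ampl n A * ampl n B := by
  rw [ampl, ampl, ampl, ← Matrix.mul_kronecker_mul, one_mul]

lemma ampl_sub (A B : Matrix (Fin m) (Fin m) ℂ) : ampl n (A - B) = ampl n A - ampl n B := by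
  ext i j
  simp [ampl, sub_mul]

lemma ampl_one : ampl n (1 : Matrix (Fin m) (Fin m) ℂ) = 1 := by
  rw [ampl, Matrix.one_kronecker_one]

lemma conjTranspose_ampl (A : Matrix (Fin m) (Fin m) ℂ) : (ampl n A)ᴴ = ampl n Aᴴ := by
  rw [ampl, ampl, Matrix.conjTranspose_kronecker, Matrix.conjTranspose_one]

lemma continuous_ampl : Continuous (ampl n : Matrix (Fin m) (Fin m) ℂ → _) := by
  refine continuous_matrix fun i j => ?_
  simp only [ampl]
  exact (continuous_id.matrix_elem _ _).mul continuous_const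

lemma continuous_partialTrace₂ :
    Continuous (partialTrace₂ : Matrix (Fin m × Fin n) (Fin m × Fin n) ℂ → _) := by
  refine continuous_matrix fun i j => ?_
  simp only [partialTrace₂, Matrix.of_apply]
  exact continuous_finsetSum _ fun k _ => continuous_id.matrix_elem _ _

lemma trace_mul_ampl (X : Matrix (Fin m × Fin n) (Fin m × Fin n) ℂ)
    (C : Matrix (Fin m) (Fin m) ℂ) : (X * ampl n C).trace = (partialTrace₂ X * C).trace := by
  simp only [Matrix.trace, Matrix.diag_apply, Matrix.mul_apply, ampl, Matrix.kronecker_apply,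
    partialTrace₂, Matrix.of_apply, Fintype.sum_prod_type, Matrix.one_apply, mul_ite, mul_one,
    mul_zero, Finset.sum_ite_eq', Finset.mem_univ, if_true, Finset.sum_mul]
  exact Finset.sum_congr rfl fun i _ => Finset.sum_comm

lemma trace_partialTrace₂ (X : Matrix (Fin m × Fin n) (Fin m × Fin n) ℂ) :
    (partialTrace₂ X).trace = X.trace := by
  rw [← mul_one (partialTrace₂ X), ← trace_mul_ampl, ampl_one, mul_one]

lemma partialTrace₂_sub (X Y : Matrix (Fin m × Fin n) (Fin m × Fin n) ℂ) :
    partialTrace₂ (X - Y) = partialTrace₂ X - partialTrace₂ Y := by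
  ext i j
  simp [partialTrace₂]

lemma posSemidef_partialTrace₂ (hX : X.PosSemidef) : (partialTrace₂ X).PosSemidef := by
  have h : partialTrace₂ X = ∑ k : Fin n, X.submatrix (fun i => (i, k)) (fun i => (i, k)) := by
    ext i j
    simp [partialTrace₂, Matrix.sum_apply]
  rw [h]
  exact Matrix.posSemidef_sum _ fun k _ => hX.submatrix _

lemma matPow_half_mul_self {ι : Type*} [Fintype ι] [DecidableEq ι] {A : Matrix ι ι ℂ}
    (hA : A.PosSemidef) : matPow A (1 / 2) * matPow A (1 / 2) = A := by
  rw [matPow_mul_matPow hA (by norm_num), add_halves, matPow_one hA.1]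

/-- The orthogonal projection onto the kernel of a Hermitian matrix. -/
noncomputable def kerProj {ι : Type*} [Fintype ι] [DecidableEq ι] (A : Matrix ι ι ℂ) :
    Matrix ι ι ℂ :=
  cfc (fun t : ℝ => if t = 0 then 1 else 0) A

lemma mul_kerProj {ι : Type*} [Fintype ι] [DecidableEq ι] {A : Matrix ι ι ℂ}
    (hA : A.IsHermitian) : A * kerProj A = 0 := by
  have hA_id : cfc (fun t : ℝ => t) A = A := cfc_id' ℝ A hA
  have hA_zero : cfc (fun _ : ℝ => (0 : ℝ)) A = 0 := cfc_const_zero ℝ A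
  have h := cfc_mul_cfc (fun t : ℝ => t) (fun t : ℝ => if t = 0 then 1 else 0) A
  rw [hA_id] at h
  rw [kerProj, h, ← hA_zero]
  congr 1
  ext t
  simp

lemma kerProj_mul_self {ι : Type*} [Fintype ι] [DecidableEq ι] (A : Matrix ι ι ℂ) :
    kerProj A * kerProj A = kerProj A := by
  rw [kerProj, cfc_mul_cfc]
  congr 1
  ext t
  split_ifs <;> simp

lemma matPow_half_mul_ampl_kerProj (hX : X.PosSemidef) :
    matPow X (1 / 2) * ampl n (kerProj (partialTrace₂ X)) = 0 := by
  rw [← Matrix.trace_conjTranspose_mul_self_eq_zero_iff, Matrix.conjTranspose_mul,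
    conjTranspose_ampl, (isHermitian_matPow X _).eq,
    (show (kerProj (partialTrace₂ X)).IsHermitian from isHermitian_cfc _ _).eq,
    Matrix.mul_assoc, ← Matrix.mul_assoc (matPow X _), matPow_half_mul_self hX,
    Matrix.trace_mul_comm, Matrix.mul_assoc, ← ampl_mul, kerProj_mul_self, trace_mul_ampl,
    mul_kerProj (posSemidef_partialTrace₂ hX).1, Matrix.trace_zero]

/-- `X` is supported on the tensor product of the support of its marginal with the whole space. -/
lemma mul_ampl_one_sub_kerProj (hX : X.PosSemidef) :
    matPow X (1 / 2) * ampl n (1 - kerProj (partialTrace₂ X)) = matPow X (1 / 2) := by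
  rw [ampl_sub, ampl_one, mul_sub, mul_one, matPow_half_mul_ampl_kerProj hX, sub_zero]

lemma matPow_mul_matPow_neg {ι : Type*} [Fintype ι] [DecidableEq ι] {A : Matrix ι ι ℂ}
    (hA : A.PosSemidef) {s : ℝ} (hs : s ≠ 0) :
    matPow A s * matPow A (-s) = 1 - kerProj A := by
  have hA_one : cfc (fun _ : ℝ => (1 : ℝ)) A = 1 := cfc_const_one ℝ A hA.1
  have h : cfc (fun t : ℝ => 1 - (if t = 0 then 1 else 0)) A = 1 - kerProj A := by
    rw [kerProj, ← hA_one]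
    exact cfc_sub _ _ A (continuousOn_spectrum _ A) (continuousOn_spectrum _ A)
  rw [← h, matPow, matPow, cfc_mul_cfc]
  refine cfc_congr_nonneg hA fun t ht => ?_
  rcases ht.eq_or_lt with rfl | ht
  · simp [Real.zero_rpow hs]
  · rw [← Real.rpow_add ht, add_neg_cancel, Real.rpow_zero, if_neg ht.ne', sub_zero]

lemma posSemidef_vMat (X : Matrix (Fin m × Fin n) (Fin m × Fin n) ℂ) (p : ℝ)
    {B : Matrix (Fin m) (Fin m) ℂ} (hB : B.PosSemidef) : (vMat X p B).PosSemidef := by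
  have h := (posSemidef_matPow hB (1 / p - 1)).kronecker
    (Matrix.PosSemidef.one (n := Fin n) (R := ℂ))
  have h2 := h.mul_mul_conjTranspose_same (matPow X (1 / 2))
  rwa [(isHermitian_matPow X _).eq] at h2

lemma norm1p_le_schattenNorm_vMat (hX : IsDensity X) {p : ℝ} (hp : 1 < p) :
    norm1p p X ≤ schattenNorm p (vMat X p (partialTrace₂ X)) := by
  set S := partialTrace₂ X
  have hS : S.PosSemidef := posSemidef_partialTrace₂ hX.1
  have hS1 : S.trace = 1 := (trace_partialTrace₂ X).trans hX.2
  have hp0 : p ≠ 0 := by positivity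
  have hp1 : p - 1 ≠ 0 := by linarith
  -- Since `2p' s = 1`, the outer factors `S ^ s` have norm `(Tr S) ^ s = 1`. The middle factor is
  -- `Gᴴ G` with `G = X ^ (1/2) (S ^ (-s) ⊗ I)`, which has the same spectrum as `v(p, S) = G Gᴴ`.
  set s : ℝ := (1 - 1 / p) / 2 with hs_def
  have hs : s ≠ 0 := by
    have : s = (p - 1) / (2 * p) := by rw [hs_def]; field_simp
    rw [this]
    positivity
  have hA : schattenNorm (2 * (p / (p - 1))) (matPow S s) = 1 := by
    have he : s * (2 * (p / (p - 1))) = 1 := by rw [hs_def]; field_simp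
    rw [schattenNorm_of_posSemidef (posSemidef_matPow hS s), matPow_matPow hS, he,
      matPow_one hS.1, hS1, Complex.one_re, Real.one_rpow]
  set R := matPow X (1 / 2)
  set G := R * ampl n (matPow S (-s))
  have hG : Gᴴ = ampl n (matPow S (-s)) * R := by
    rw [Matrix.conjTranspose_mul, conjTranspose_ampl, (isHermitian_matPow S _).eq,
      (isHermitian_matPow X _).eq]
  have hv : vMat X p S = G * Gᴴ := by
    have he : 1 / p - 1 = -s + -s := by rw [hs_def]; ring
    have he0 : -s + -s ≠ 0 := by
      intro h
      exact hs (by linarith)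
    rw [hG, vMat, he, ← matPow_mul_matPow hS he0, ampl_mul]
    simp only [G, R, Matrix.mul_assoc]
  have hcomm : matPow S (-s) * matPow S s = 1 - kerProj S := by
    have := matPow_mul_matPow_neg hS (neg_ne_zero.2 hs)
    rwa [neg_neg] at this
  have hGA : G * ampl n (matPow S s) = R := by
    rw [Matrix.mul_assoc, ← ampl_mul, hcomm]
    exact mul_ampl_one_sub_kerProj hX.1
  have hAG : ampl n (matPow S s) * Gᴴ = R := by
    rw [← (isHermitian_matPow S s).eq, ← conjTranspose_ampl, ← Matrix.conjTranspose_mul, hGA]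
    exact (isHermitian_matPow X _).eq
  refine csInf_le ⟨0, ?_⟩ ⟨matPow S s, matPow S s, Gᴴ * G, ?_, ?_⟩
  · rintro _ ⟨A, B, Z, -, rfl⟩
    exact mul_nonneg (mul_nonneg (schattenNorm_nonneg _ _) (schattenNorm_nonneg _ _))
      (schattenNorm_nonneg _ _)
  · rw [← Matrix.mul_assoc, hAG, Matrix.mul_assoc, hGA]
    exact (matPow_half_mul_self hX.1).symm
  · rw [hA, one_mul, one_mul, schattenNorm_conjTranspose_mul_self, hv]

lemma trace_matPow_vMat_le_of_isMinimizer (hX : IsDensity X) {p : ℝ} (hp : 1 < p)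
    {B : Matrix (Fin m) (Fin m) ℂ} (hB : IsMinimizer X p B) :
    (matPow (vMat X p B) p).trace.re ≤ (matPow (vMat X p (partialTrace₂ X)) p).trace.re := by
  have hv := posSemidef_vMat X p hB.1.1.1
  have hw := posSemidef_vMat X p (posSemidef_partialTrace₂ hX.1)
  have h := hB.2.le.trans (norm1p_le_schattenNorm_vMat hX hp)
  rw [schattenNorm_of_posSemidef hv, schattenNorm_of_posSemidef hw] at h
  exact (Real.rpow_le_rpow_iff (trace_matPow_re_nonneg hv p) (trace_matPow_re_nonneg hw p)
    (by positivity)).1 h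

/-- The marginal of `X ^ s` for `s ≥ 1` is dominated by that of `X`, so its support is no larger. -/
lemma trace_partialTrace₂_matPow_mul_kerProj (hX : IsDensity X) {s : ℝ} (hs : 1 ≤ s)
    {B : Matrix (Fin m) (Fin m) ℂ} (hB : B ∈ admissible X) :
    (partialTrace₂ (matPow X s) * kerProj B).trace.re = 0 := by
  have hQ : (kerProj B).IsHermitian := isHermitian_cfc _ _
  have hXQ : partialTrace₂ X * kerProj B = 0 := by
    have hBQ := mul_kerProj hB.1.1.1
    refine Matrix.ext_of_mulVec_single fun j => ?_
    have hmem : (kerProj B *ᵥ Pi.single j 1) ∈ LinearMap.ker B.mulVecLin := by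
      rw [LinearMap.mem_ker, Matrix.mulVecLin_apply, Matrix.mulVec_mulVec, hBQ, Matrix.zero_mulVec]
    have h := hB.2 hmem
    rw [LinearMap.mem_ker, Matrix.mulVecLin_apply, Matrix.mulVec_mulVec] at h
    rw [h, Matrix.zero_mulVec]
  have key : ∀ Y : Matrix (Fin m × Fin n) (Fin m × Fin n) ℂ, Y.PosSemidef →
      0 ≤ (partialTrace₂ Y * kerProj B).trace.re := fun Y hY => by
    have h := (hY.conjTranspose_mul_mul_same (ampl n (kerProj B))).trace_nonneg
    rw [conjTranspose_ampl, hQ.eq, Matrix.trace_mul_comm, ← Matrix.mul_assoc, ← ampl_mul,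
      kerProj_mul_self, Matrix.trace_mul_comm, trace_mul_ampl] at h
    exact (Complex.le_def.1 h).1
  -- The eigenvalues of a density matrix lie in `[0, 1]`, where `t ^ s ≤ t`.
  have hdiff : (X - matPow X s).PosSemidef := by
    have hX_id : cfc (fun t : ℝ => t) X = X := cfc_id' ℝ X hX.1.1
    have h : cfc (fun t : ℝ => t - t ^ s) X = X - matPow X s := by
      conv_rhs => rw [← hX_id]
      rw [matPow, hX_id]
      refine (cfc_sub (fun t : ℝ => t) (fun t : ℝ => t ^ s) X (continuousOn_spectrum _ X)
        (continuousOn_spectrum _ X)).trans ?_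
      congr 1
    rw [← h]
    refine posSemidef_cfc hX.1.1 fun i => sub_nonneg.2 ?_
    have h1 : hX.1.1.eigenvalues i ≤ 1 :=
      (eigenvalues_le_trace hX.1 i).trans (by rw [hX.2, Complex.one_re])
    exact (Real.rpow_le_rpow_of_exponent_ge' (hX.1.eigenvalues_nonneg i) h1 zero_le_one hs).trans
      (Real.rpow_one _).le
  have h2 := key _ hdiff
  rw [partialTrace₂_sub, sub_mul, hXQ, zero_sub, Matrix.trace_neg, Complex.neg_re] at h2
  exact le_antisymm (by linarith) (key _ (posSemidef_matPow hX.1 s))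

end Tensor

/-! ### Entropy as the derivative of power traces at exponent one -/

section Limits

/-- Convexity of `q ↦ x ^ q` makes its secant slopes from `1` increase. This lets the moving
exponent `p` be traded for a fixed `q` while the matrix `v(p, S)` is still moving. -/
lemma rpow_sub_self_div_le {x p q : ℝ} (hx : 0 ≤ x) (hp : 1 < p) (hpq : p ≤ q) :
    (x ^ p - x) / (p - 1) ≤ (x ^ q - x) / (q - 1) := by
  rcases hx.eq_or_lt with rfl | hx
  · simp [Real.zero_rpow (by linarith : p ≠ 0), Real.zero_rpow (by linarith : q ≠ 0)]
  rcases hpq.eq_or_lt with rfl | hpq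
  · rfl
  have h := (convexOn_exp.comp_linearMap (LinearMap.mulLeft ℝ (Real.log x))).secant_mono
    (a := 1) (x := p) (y := q) trivial trivial trivial hp.ne' (hp.trans hpq).ne' hpq.le
  simpa [Real.rpow_def_of_pos hx, Real.exp_log hx] using h

lemma sub_mul_negMulLog_le_rpow {x ε : ℝ} (hx : 0 ≤ x) (hε : 0 < ε) :
    x - ε * Real.negMulLog x ≤ x ^ (1 + ε) := by
  rcases hx.eq_or_lt with rfl | hx
  · simp [Real.zero_rpow (by linarith : 1 + ε ≠ 0)]
  rw [Real.rpow_add hx, Real.rpow_one, Real.rpow_def_of_pos hx, Real.negMulLog]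
  have := mul_le_mul_of_nonneg_left (Real.add_one_le_exp (Real.log x * ε)) hx.le
  linarith

lemma tendsto_rpow_sub_self_div (x : ℝ) (hx : 0 ≤ x) :
    Tendsto (fun q : ℝ => (x ^ q - x) / (q - 1)) (𝓝[>] 1) (𝓝 (-Real.negMulLog x)) := by
  rcases hx.eq_or_lt with rfl | hx
  · refine tendsto_const_nhds.congr' ?_
    filter_upwards [self_mem_nhdsWithin] with q hq
    have hq0 : q ≠ 0 := (zero_lt_one.trans hq).ne'
    simp [Real.zero_rpow hq0]
  have h : HasDerivAt (fun q : ℝ => x ^ q) (x ^ (1 : ℝ) * Real.log x) 1 :=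
    (Real.hasStrictDerivAt_const_rpow hx 1).hasDerivAt
  have h2 := (hasDerivAt_iff_tendsto_slope.1 h).mono_left
    (nhdsWithin_mono 1 (fun q (hq : 1 < q) => hq.ne'))
  rw [Real.rpow_one] at h2
  have he : -Real.negMulLog x = x * Real.log x := by rw [Real.negMulLog]; ring
  rw [he]
  refine h2.congr fun q => ?_
  rw [slope_def_field, Real.rpow_one]

lemma tendsto_rpow_one_div_sub_self_div (x : ℝ) (hx : 0 ≤ x) :
    Tendsto (fun p : ℝ => (x ^ (1 / p) - x) / (p - 1)) (𝓝[>] 1) (𝓝 (Real.negMulLog x)) := by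
  rcases hx.eq_or_lt with rfl | hx
  · refine tendsto_const_nhds.congr' ?_
    filter_upwards [self_mem_nhdsWithin] with q hq
    have hq0 : q ≠ 0 := (zero_lt_one.trans hq).ne'
    simp [Real.zero_rpow (inv_ne_zero hq0)]
  have h0 : HasDerivAt (fun q : ℝ => x ^ q) (x ^ (1 : ℝ) * Real.log x) ((1 : ℝ)⁻¹) := by
    rw [inv_one]
    exact (Real.hasStrictDerivAt_const_rpow hx 1).hasDerivAt
  have h : HasDerivAt (fun p : ℝ => x ^ p⁻¹) (x ^ (1 : ℝ) * Real.log x * -((1 : ℝ) ^ 2)⁻¹) 1 :=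
    h0.comp 1 (hasDerivAt_inv one_ne_zero)
  have h2 := (hasDerivAt_iff_tendsto_slope.1 h).mono_left
    (nhdsWithin_mono 1 (fun q (hq : 1 < q) => hq.ne'))
  have he : x ^ (1 : ℝ) * Real.log x * -((1 : ℝ) ^ 2)⁻¹ = Real.negMulLog x := by
    rw [Real.negMulLog, Real.rpow_one]; ring
  rw [he] at h2
  refine h2.congr fun q => ?_
  rw [slope_def_field, inv_one, Real.rpow_one, one_div]

variable {ι : Type*} [Fintype ι] [DecidableEq ι] {A : Matrix ι ι ℂ}

lemma trace_re_eq_sum_eigenvalues (hA : A.IsHermitian) : A.trace.re = ∑ i, hA.eigenvalues i := by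
  rw [hA.trace_eq_sum_eigenvalues, Complex.re_sum]
  simp

lemma trace_matPow_sub_trace_div_le (hA : A.PosSemidef) {p q : ℝ} (hp : 1 < p) (hpq : p ≤ q) :
    ((matPow A p).trace.re - A.trace.re) / (p - 1) ≤
      ((matPow A q).trace.re - A.trace.re) / (q - 1) := by
  rw [matPow, matPow, trace_cfc_re hA.1, trace_cfc_re hA.1, trace_re_eq_sum_eigenvalues hA.1,
    ← Finset.sum_sub_distrib, ← Finset.sum_sub_distrib, Finset.sum_div, Finset.sum_div]
  exact Finset.sum_le_sum fun i _ => rpow_sub_self_div_le (hA.eigenvalues_nonneg i) hp hpq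

lemma trace_sub_mul_entropy_le (hA : A.PosSemidef) {ε : ℝ} (hε : 0 < ε) :
    A.trace.re - ε * (cfc Real.negMulLog A).trace.re ≤ (matPow A (1 + ε)).trace.re := by
  rw [matPow, trace_cfc_re hA.1, trace_cfc_re hA.1, trace_re_eq_sum_eigenvalues hA.1,
    Finset.mul_sum, ← Finset.sum_sub_distrib]
  exact Finset.sum_le_sum fun i _ => sub_mul_negMulLog_le_rpow (hA.eigenvalues_nonneg i) hε

lemma tendsto_trace_matPow_sub_trace_div (hA : A.PosSemidef) :
    Tendsto (fun q => ((matPow A q).trace.re - A.trace.re) / (q - 1)) (𝓝[>] 1)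
      (𝓝 (-(cfc Real.negMulLog A).trace.re)) := by
  simp only [matPow, trace_cfc_re hA.1, trace_re_eq_sum_eigenvalues hA.1,
    ← Finset.sum_sub_distrib, Finset.sum_div, ← Finset.sum_neg_distrib]
  exact tendsto_finsetSum _ fun i _ => tendsto_rpow_sub_self_div _ (hA.eigenvalues_nonneg i)

lemma tendsto_trace_matPow_one_div_sub_trace_div (hA : A.PosSemidef) :
    Tendsto (fun p => ((matPow A (1 / p)).trace.re - A.trace.re) / (p - 1)) (𝓝[>] 1)
      (𝓝 (cfc Real.negMulLog A).trace.re) := by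
  simp only [matPow, trace_cfc_re hA.1, trace_re_eq_sum_eigenvalues hA.1,
    ← Finset.sum_sub_distrib, Finset.sum_div]
  exact tendsto_finsetSum _ fun i _ =>
    tendsto_rpow_one_div_sub_self_div _ (hA.eigenvalues_nonneg i)

lemma tendsto_one_div_nhdsGT_one : Tendsto (fun p : ℝ => 1 / p) (𝓝[>] 1) (𝓝 1) := by
  have h : ContinuousAt (fun p : ℝ => 1 / p) 1 := by fun_prop (disch := norm_num)
  simpa using (h.tendsto.mono_left nhdsWithin_le_nhds : Tendsto _ (𝓝[>] (1 : ℝ)) _)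

lemma tendsto_matPow_self (hA : A.PosSemidef) :
    Tendsto (fun p : ℝ => matPow A (1 + (1 - 1 / p))) (𝓝[>] 1) (𝓝 A) := by
  have hA_id : cfc (fun t : ℝ => t ^ (1 : ℝ)) A = A := matPow_one hA.1
  conv_rhs => rw [← hA_id]
  refine tendsto_cfc_of_pointwise hA.1 fun i => ?_
  have h : Tendsto (fun p : ℝ => 1 + (1 - 1 / p)) (𝓝[>] 1) (𝓝 1) := by
    simpa using (tendsto_one_div_nhdsGT_one.const_sub 1).const_add 1
  exact tendsto_const_nhds.rpow h (Or.inr one_pos)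

/-- The limit is the support projection, not `1`, because negative powers vanish on the kernel. -/
lemma tendsto_matPow_one_sub_kerProj (hA : A.PosSemidef) :
    Tendsto (fun p : ℝ => matPow A (1 / p - 1)) (𝓝[>] 1) (𝓝 (1 - kerProj A)) := by
  have hA_one : cfc (fun _ : ℝ => (1 : ℝ)) A = 1 := cfc_const_one ℝ A hA.1
  have h : cfc (fun t : ℝ => 1 - (if t = 0 then 1 else 0)) A = 1 - kerProj A := by
    rw [kerProj, ← hA_one]
    exact cfc_sub _ _ A (continuousOn_spectrum _ A) (continuousOn_spectrum _ A)
  rw [← h]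
  refine tendsto_cfc_of_pointwise hA.1 fun i => ?_
  have he : Tendsto (fun p : ℝ => 1 / p - 1) (𝓝[>] 1) (𝓝 0) := by
    simpa using tendsto_one_div_nhdsGT_one.sub_const 1
  rcases (hA.eigenvalues_nonneg i).eq_or_lt with h0 | hpos
  · refine tendsto_const_nhds.congr' ?_
    filter_upwards [self_mem_nhdsWithin] with p hp
    have hp' : 1 / p - 1 ≠ 0 := by
      have : 1 / p < 1 := (div_lt_one (zero_lt_one.trans hp)).2 hp
      linarith
    simp only [← h0, if_true, sub_self, Real.zero_rpow hp']
  · rw [if_neg hpos.ne', sub_zero]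
    have := (tendsto_const_nhds (x := hA.1.eigenvalues i)).rpow he (Or.inl hpos.ne')
    rwa [Real.rpow_zero] at this

end Limits

/-! ### Convergence of the minimizers -/

section Convergence

variable {m n : ℕ} {X : Matrix (Fin m × Fin n) (Fin m × Fin n) ℂ}

lemma tendsto_vMat_partialTrace₂ (hX : X.PosSemidef) :
    Tendsto (fun p : ℝ => vMat X p (partialTrace₂ X)) (𝓝[>] 1) (𝓝 X) := by
  have h := (tendsto_const_nhds (x := matPow X (1 / 2))).mul
    ((continuous_ampl (n := n).tendsto _).comp
      (tendsto_matPow_one_sub_kerProj (posSemidef_partialTrace₂ hX))) |>.mul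
    (tendsto_const_nhds (x := matPow X (1 / 2)))
  rwa [mul_ampl_one_sub_kerProj hX, matPow_half_mul_self hX] at h

lemma trace_vMat_partialTrace₂ (hX : X.PosSemidef) {p : ℝ} (hp : 1 < p) :
    (vMat X p (partialTrace₂ X)).trace = (matPow (partialTrace₂ X) (1 / p)).trace := by
  have hS := posSemidef_partialTrace₂ hX
  have h : 1 + (1 / p - 1) ≠ 0 := by
    rw [add_sub_cancel]
    positivity
  rw [vMat, Matrix.trace_mul_cycle, matPow_half_mul_self hX, trace_mul_ampl]
  nth_rewrite 1 [← matPow_one hS.1]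
  rw [matPow_mul_matPow hS h, add_sub_cancel]

lemma trace_vMat_mul_matPow (hX : X.PosSemidef) (B : Matrix (Fin m) (Fin m) ℂ) {p : ℝ}
    (hp : 1 < p) :
    (vMat X p B * matPow X (1 - 1 / p)).trace =
      (partialTrace₂ (matPow X (1 + (1 - 1 / p))) * matPow B (-(1 - 1 / p))).trace := by
  have hε : 0 < 1 - 1 / p := by
    have : 1 / p < 1 := (div_lt_one (zero_lt_one.trans hp)).2 hp
    linarith
  have he : 1 / 2 + (1 - 1 / p) + 1 / 2 = 1 + (1 - 1 / p) := by ring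
  rw [← trace_mul_ampl, vMat, Matrix.mul_assoc, Matrix.mul_assoc,
    Matrix.trace_mul_comm, Matrix.mul_assoc, Matrix.trace_mul_comm,
    matPow_mul_matPow hX (by linarith), matPow_mul_matPow hX (by linarith), neg_sub, he]

/-- The distance of a minimizer to the marginal of `X ^ (2 - 1 / p)` is controlled by difference
quotients of traces of powers and by entropies. -/
lemma trace_sq_sub_minimizer_le (hX : IsDensity X) {p q : ℝ} (hp : 1 < p) (hpq : p ≤ q)
    {B : Matrix (Fin m) (Fin m) ℂ} (hB : IsMinimizer X p B) {Y : Matrix (Fin m) (Fin m) ℂ}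
    (hY : Y = partialTrace₂ (matPow X (1 + (1 - 1 / p)))) :
    ((Y - B) * (Y - B)).trace.re / 4 ≤
      ((matPow (vMat X p (partialTrace₂ X)) q).trace.re -
          (vMat X p (partialTrace₂ X)).trace.re) / (q - 1) +
        ((matPow (partialTrace₂ X) (1 / p)).trace.re - 1) / (p - 1) +
        (cfc Real.negMulLog X).trace.re - (cfc Real.negMulLog Y).trace.re - Y.trace.re + 1 := by
  have hp0 : 0 < p := by linarith
  have hp1 : 0 < p - 1 := by linarith
  have hε : 0 < 1 - 1 / p := by
    have : 1 / p < 1 := (div_lt_one hp0).2 hp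
    linarith
  have hXtr : X.trace.re = 1 := by rw [hX.2, Complex.one_re]
  have hYtr : Y.trace.re = (matPow X (1 + (1 - 1 / p))).trace.re := by
    rw [hY, trace_partialTrace₂]
  have hYpos : Y.PosSemidef := by
    rw [hY]
    exact posSemidef_partialTrace₂ (posSemidef_matPow hX.1 _)
  have hY1 : Y.trace.re ≤ 1 := by
    refine le_of_le_of_eq ?_ hXtr
    rw [hYtr, matPow, trace_cfc_re hX.1.1, trace_re_eq_sum_eigenvalues hX.1.1]
    refine Finset.sum_le_sum fun i _ => ?_
    have h1 : hX.1.1.eigenvalues i ≤ 1 := (eigenvalues_le_trace hX.1 i).trans hXtr.le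
    exact (Real.rpow_le_rpow_of_exponent_ge' (hX.1.eigenvalues_nonneg i) h1 zero_le_one
      (by linarith)).trans (Real.rpow_one _).le
  have hBtr : B.trace.re = 1 := by rw [hB.1.1.2, Complex.one_re]
  have hker := trace_partialTrace₂_matPow_mul_kerProj hX
    (by linarith : 1 ≤ 1 + (1 - 1 / p)) hB.1
  rw [← hY] at hker
  have gibbs := entropy_le_trace_mul_matPow hYpos hB.1.1.1 hY1 hBtr.le hε hker
  have young := trace_mul_matPow_le (posSemidef_vMat X p hB.1.1.1) hX.1 hp
  rw [trace_vMat_mul_matPow hX.1 B hp, ← hY, hXtr] at young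
  have hmin := div_le_div_of_nonneg_right (trace_matPow_vMat_le_of_isMinimizer hX hp hB) hp0.le
  have hlow := trace_sub_mul_entropy_le hX.1 hε
  rw [← hYtr, hXtr] at hlow
  have hquot := trace_matPow_sub_trace_div_le
    (posSemidef_vMat X p (posSemidef_partialTrace₂ hX.1)) hp hpq
  rw [trace_vMat_partialTrace₂ hX.1 hp] at hquot ⊢
  rw [hBtr] at gibbs
  set T := (matPow (vMat X p (partialTrace₂ X)) p).trace.re
  set t := (matPow (partialTrace₂ X) (1 / p)).trace.re
  -- As `t = Tr v(p, S)`, the first quotient involves only powers of `v(p, S)`, and the second only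
  -- the marginal.
  have hsplit : (T - 1) / (p - 1) = (T - t) / (p - 1) + (t - 1) / (p - 1) := by
    rw [← add_div]
    ring
  have hmain : (1 - 1 / p) * (((Y - B) * (Y - B)).trace.re / 4) ≤ (1 - 1 / p) *
      ((T - 1) / (p - 1) + (cfc Real.negMulLog X).trace.re - (cfc Real.negMulLog Y).trace.re -
        Y.trace.re + 1) := by
    have he : (1 - 1 / p) * ((T - 1) / (p - 1)) = T / p + (1 - 1 / p) - 1 := by
      field_simp
      ring
    linarith
  have := le_of_mul_le_mul_left hmain hε
  linarith

lemma tendsto_trace_re {ι : Type*} [Fintype ι] {A : Matrix ι ι ℂ} {α : Type*}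
    {l : Filter α} {a : α → Matrix ι ι ℂ} (h : Tendsto a l (𝓝 A)) :
    Tendsto (fun x => (a x).trace.re) l (𝓝 A.trace.re) :=
  ((Complex.continuous_re.comp (continuous_id.matrix_trace)).tendsto A).comp h

lemma norm_apply_le_sqrt_trace {ι : Type*} [Fintype ι] {M : Matrix ι ι ℂ} (hM : M.IsHermitian)
    (i j : ι) : ‖M i j‖ ≤ √(M * M).trace.re := by
  refine Real.le_sqrt_of_sq_le ?_
  have h : (M * M).trace.re = ∑ i, ∑ j, ‖M i j‖ ^ 2 := by
    rw [Matrix.trace, Complex.re_sum]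
    refine Finset.sum_congr rfl fun i _ => ?_
    rw [Matrix.diag_apply, Matrix.mul_apply, Complex.re_sum]
    refine Finset.sum_congr rfl fun j _ => ?_
    rw [← hM.apply j i, RCLike.star_def, Complex.mul_conj, Complex.ofReal_re,
      Complex.normSq_eq_norm_sq]
  rw [h]
  exact (Finset.single_le_sum (f := fun j => ‖M i j‖ ^ 2) (fun _ _ => sq_nonneg _)
    (Finset.mem_univ j)).trans (Finset.single_le_sum (f := fun i => ∑ j, ‖M i j‖ ^ 2)
      (fun _ _ => Finset.sum_nonneg fun _ _ => sq_nonneg _) (Finset.mem_univ i))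

lemma tendsto_trace_sq_sub_minimizer (hX : IsDensity X) {B : ℝ → Matrix (Fin m) (Fin m) ℂ}
    (hB : ∀ p ∈ Set.Ioc (1 : ℝ) 2, IsMinimizer X p (B p)) {Y : ℝ → Matrix (Fin m) (Fin m) ℂ}
    (hYdef : ∀ p, Y p = partialTrace₂ (matPow X (1 + (1 - 1 / p))))
    (hY : Tendsto Y (𝓝[>] 1) (𝓝 (partialTrace₂ X))) :
    ∀ η > 0, ∀ᶠ p in 𝓝[>] (1 : ℝ), ((Y p - B p) * (Y p - B p)).trace.re < η := by
  intro η hη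
  have hXtr : X.trace.re = 1 := by rw [hX.2, Complex.one_re]
  have hS := posSemidef_partialTrace₂ hX.1
  have hStr : (partialTrace₂ X).trace.re = 1 := by rw [trace_partialTrace₂, hXtr]
  have hq := (tendsto_trace_matPow_sub_trace_div hX.1).add_const (cfc Real.negMulLog X).trace.re
  rw [neg_add_cancel] at hq
  -- The order of limits matters: `q` is fixed first, with `(Tr X ^ q - 1)/(q - 1) + H(X) < η/4`,
  -- and only then `p → 1+`, so that continuity of the fixed function `t ^ q` applies.
  obtain ⟨q, hqη, hq1⟩ := ((hq.eventually_lt_const (by positivity : 0 < η / 4)).and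
    self_mem_nhdsWithin).exists
  have hq1 : 1 < q := hq1
  have hv := tendsto_vMat_partialTrace₂ hX.1
  have hvq : Tendsto (fun p => matPow (vMat X p (partialTrace₂ X)) q) (𝓝[>] 1)
      (𝓝 (matPow X q)) :=
    tendsto_cfc_of_tendsto (Real.continuous_rpow_const (by linarith))
      (Eventually.of_forall fun p => (posSemidef_vMat X p hS).1) hX.1.1 hv
  have hlogY : Tendsto (fun p => cfc Real.negMulLog (Y p)) (𝓝[>] 1)
      (𝓝 (cfc Real.negMulLog (partialTrace₂ X))) :=
    tendsto_cfc_of_tendsto Real.continuous_negMulLog (Eventually.of_forall fun p => by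
      rw [hYdef]
      exact (posSemidef_partialTrace₂ (posSemidef_matPow hX.1 _)).1) hS.1 hY
  have hder := tendsto_trace_matPow_one_div_sub_trace_div hS
  rw [hStr] at hder
  have hlim := ((((((tendsto_trace_re hvq).sub (tendsto_trace_re hv)).div_const (q - 1)).add
    hder).add_const (cfc Real.negMulLog X).trace.re).sub (tendsto_trace_re hlogY)).sub
    (tendsto_trace_re hY) |>.add_const 1
  rw [hStr] at hlim
  -- In the limit the entropies of the marginal cancel and `-Tr Y + 1` vanishes, leaving the
  -- quantity bounded by the choice of `q`.
  have hlt := hlim.eventually_lt_const (u := η / 4) (by linarith)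
  filter_upwards [hlt, Ioc_mem_nhdsGT hq1, Ioc_mem_nhdsGT one_lt_two] with p hp hpq hp2
  have := trace_sq_sub_minimizer_le hX hp2.1 hpq.2 (hB p hp2) (hYdef p)
  linarith

end Convergence

end MixedNorm

theorem mainTheorem10 {m n : ℕ} (X : Matrix (Fin m × Fin n) (Fin m × Fin n) ℂ)
    (hX : MixedNorm.IsDensity X) (B : ℝ → Matrix (Fin m) (Fin m) ℂ)
    (hB : ∀ p ∈ Set.Ioc (1 : ℝ) 2, MixedNorm.IsMinimizer X p (B p)) :
    Tendsto B (𝓝[>] (1 : ℝ)) (𝓝 (MixedNorm.partialTrace₂ X)) := by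
  set Y : ℝ → Matrix (Fin m) (Fin m) ℂ := fun p =>
    MixedNorm.partialTrace₂ (MixedNorm.matPow X (1 + (1 - 1 / p)))
  have hY : Tendsto Y (𝓝[>] 1) (𝓝 (MixedNorm.partialTrace₂ X)) :=
    (MixedNorm.continuous_partialTrace₂.tendsto X).comp (MixedNorm.tendsto_matPow_self hX.1)
  have hD := MixedNorm.tendsto_trace_sq_sub_minimizer hX hB (fun _ => rfl) hY
  have hdiff : Tendsto (fun p => Y p - B p) (𝓝[>] 1) (𝓝 0) := by
    refine tendsto_pi_nhds.2 fun i => tendsto_pi_nhds.2 fun j => ?_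
    refine Metric.tendsto_nhds.2 fun η hη => ?_
    filter_upwards [hD (η ^ 2) (by positivity), Ioc_mem_nhdsGT one_lt_two] with p hp hp2
    have hM : (Y p - B p).IsHermitian := (MixedNorm.posSemidef_partialTrace₂
      (MixedNorm.posSemidef_matPow hX.1 _)).1.sub (hB p hp2).1.1.1.1
    rw [Matrix.zero_apply, dist_zero_right]
    exact (MixedNorm.norm_apply_le_sqrt_trace hM i j).trans_lt ((Real.sqrt_lt' hη).2 hp)
  simpa using hY.sub hdiff
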